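/- Let $E=(E^0,E^1,d,r)$ be a topological graph: $E^0,E^1$ are locally compact Hausdorff spaces, $r:E^1\to E^0$ is continuous and $d:E^1\to E^0$ is a local homeomorphism. For $n\ge 0$ let $E^n$ be the set of paths $e_1\cdots e_n$ of length $n$ (with $d(e_i)=r(e_{i+1})$; for $n=0$ these are the vertices), topologized as the subspace of all $(v,e_1,\dots,e_n)\in E^0\times (E^1)^n$ such that $d(e_i)=r(e_{i+1})$ for $1\le i<n$ and, if $n\ge1$, $v=r(e_1)$. Put $d(e_1\cdots e_n)=d(e_n)$ for $n\ge 1$ and $d(v)=v$ for $v\in E^0$. Let $E^*=\bigsqcup_n E^n$ have the disjoint union topology, and let $E^\infty$ be the set of infinite paths $e_1e_2\cdots$ with $d(e_i)=r(e_{i+1})$. For $A\subseteq E^n$ let $Z(A)\subseteq E^*\cup E^\infty$ be the set of all paths of length at least $n$ whose prefix of length $n$ lies in $A$, and for $K\subseteq E^*$ let $Z(K)=\bigcup_n Z(K\cap E^n)$. Give $X=E^*\cup E^\infty$ the patch topology of the topology $\tau_{cyl}$ generated by the sets $Z(U)$ with $U\subseteq E^n$ open, $n\ge0$, i.e. the coarsest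 topology containing $\tau_{cyl}$ and the complements of all $\tau_{cyl}$-compact sets that are intersections of $\tau_{cyl}$-open sets. Let $\mathcal B$ be the meet-semilattice (under inclusion) of all sets $Z(U)\cap Z(K)^c$ with $n\ge 0$, $U\subseteq E^n$ open and $K\subseteq E^*$ compact. Define a coverage $C'$ on $\mathcal B$ as follows. For each presentation $a=Z(U)\cap Z(K)^c$ of $a\in\mathcal B$ with $U\subseteq E^n$ open and $K\subseteq E^*$ compact, the following families are coverings of $a$: 1. (continuation coverings) $\{\emptyset\}\cup\{Z((U\times B_i)\cap E^{n+1})\cap Z(K)^c : 1\le i\le k\}$, whenever $d(U)\subseteq r(E^1)$ and $B_1,\dots,B_k$ are finitely many open, relatively compact subsets of $E^1$ such that each $d|_{B_i}$ is a homeomorphism onto its image and $\bigcup_i B_i=r^{-1}(d(U))$; 2. (topological coverings) $\{\emptyset\}\cup\{Z(U_\lambda)\cap Z(K)^c:\lambda\in\Lambda\}$, for every family $(U_\lambda)_{\lambda\in\Lambda}$ of open subsets of $E^n$ with $\bigcup_\lambda U_\lambda=U$. Let $C$ be the coverage on $\mathcal B$ in which the coverings of $a$ are all $S\subseteq\mathcal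 B$ with $\bigcup S=a$, and let $\overline C=C\cup C'$. A $\overline C$-ideal is a downward closed $I\subseteq\mathcal B$ such that $a\in I$ whenever $I$ contains some $S\in\overline C(a)$. Let $G$ be the frame of all $\overline C$-ideals, ordered by inclusion, and let $f:\Omega(X)\to G$ send an open set $W\subseteq X$ to the smallest $\overline C$-ideal containing $\{b\in\mathcal B: b\subseteq W\}$. Let $Y\subseteq X$ be the subspace corresponding to the sublocale $G$, i.e. the set of all $x\in X$ for which there is a frame homomorphism $p:G\to\{0<1\}$ such that, for every open $W\subseteq X$, $p(f(W))=1$ if and only if $x\in W$. Let $E^0_{sce}=E^0\setminus\overline{r(E^1)}$, let $E^0_{fin}$ be the set of vertices having a neighbourhood $V$ with $r^{-1}(V)$ compact, and put $E^0_{rg}=E^0_{fin}\setminus\overline{E^0_{sce}}$ and $E^0_{sg}=E^0\setminus E^0_{rg}$. Then $Y$ is the boundary path space of $E$: $$Y=\partial E=\{\mu\in E^*: d(\mu)\in E^0_{sg}\}\cup E^\infty .$$ -/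

import Mathlib

open Set Topology TopologicalSpace

/-! ## Coverages, ideals and the subspace attached to a coverage -/

/-- A coverage on a meet-semilattice: every element `a` gets a collection of coverings, which are
subsets of the lower set of `a`, subject to the meet-stability condition. -/
structure SiteCoverage (A : Type*) [SemilatticeInf A] where
  covers : A → Set (Set A)
  le_of_mem : ∀ {a : A} {S : Set A}, S ∈ covers a → ∀ s ∈ S, s ≤ a
  meet_stable : ∀ {a : A} {S : Set A}, S ∈ covers a → ∀ b : A, b ≤ a →
    (fun s => s ⊓ b) '' S ∈ covers b

namespace SiteCoverage

variable {A : Type*} [SemilatticeInf A]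

/-- A `C`-ideal: a lower set that contains every element one of whose coverings it contains. -/
def IsIdeal (C : SiteCoverage A) (I : Set A) : Prop :=
  IsLowerSet I ∧ ∀ a : A, ∀ S ∈ C.covers a, S ⊆ I → a ∈ I

/-- The set of all `C`-ideals, ordered by inclusion. -/
def Ideal (C : SiteCoverage A) : Type _ := {I : Set A // C.IsIdeal I}

instance (C : SiteCoverage A) : PartialOrder C.Ideal :=
  inferInstanceAs (PartialOrder {I : Set A // C.IsIdeal I})

/-- Meets of `C`-ideals are intersections. -/
instance (C : SiteCoverage A) : InfSet C.Ideal where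
  sInf T := ⟨⋂ I ∈ T, I.1, by
    refine ⟨isLowerSet_iInter₂ fun I _ => I.2.1, fun a S hS hSI => ?_⟩
    refine mem_iInter₂.2 fun I hI => I.2.2 a S hS fun s hs => ?_
    exact mem_iInter₂.1 (hSI hs) I hI⟩

/-- Joins of `C`-ideals are then the ideals generated by the unions. -/
instance (C : SiteCoverage A) : CompleteLattice C.Ideal :=
  completeLatticeOfInf C.Ideal fun T => by
    refine ⟨fun I hI => ?_, fun J hJ => ?_⟩
    · change (⋂ I ∈ T, I.1) ⊆ I.1
      exact biInter_subset_of_mem hI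
    · change J.1 ⊆ ⋂ I ∈ T, I.1
      exact subset_iInter₂ fun I hI => hJ hI

/-- The coverage `C ∪ C'`, computed elementwise. -/
def union (C C' : SiteCoverage A) : SiteCoverage A where
  covers a := C.covers a ∪ C'.covers a
  le_of_mem h := h.elim (fun h => C.le_of_mem h) (fun h => C'.le_of_mem h)
  meet_stable h b hb :=
    h.elim (fun h => Or.inl (C.meet_stable h b hb)) (fun h => Or.inr (C'.meet_stable h b hb))

/-- The map `I ↦ ⋂ {I' | I ⊆ I', I' a (C ∪ C')-ideal}` from `C`-ideals onto `(C ∪ C')`-ideals. -/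
def nucleus (C C' : SiteCoverage A) (I : C.Ideal) : (C.union C').Ideal :=
  sInf {I' | I.1 ⊆ I'.1}

end SiteCoverage

/-- A family of subsets of `X` closed under binary intersections. -/
structure SetSemilattice (X : Type*) where
  sets : Set (Set X)
  inter_mem : ∀ ⦃a b : Set X⦄, a ∈ sets → b ∈ sets → a ∩ b ∈ sets

namespace SetSemilattice

variable {X : Type*}

/-- The elements of the family, as a meet-semilattice under inclusion. -/
abbrev Elem (B : SetSemilattice X) : Type _ := {a : Set X // a ∈ B.sets}

instance (B : SetSemilattice X) : SemilatticeInf B.Elem :=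
  Subtype.semilatticeInf B.inter_mem

/-- The coverage in which the coverings of `a` are all families of members of `B` with union `a`. -/
def joinCoverage (B : SetSemilattice X) : SiteCoverage B.Elem where
  covers a := {S | ⋃ s ∈ S, s.1 = a.1}
  le_of_mem := by
    intro a S hS s hs
    change s.1 ⊆ a.1
    rw [← show (⋃ s ∈ S, s.1) = a.1 from hS]
    exact subset_biUnion_of_mem (u := fun s : B.Elem => s.1) hs
  meet_stable := by
    intro a S hS b hb
    have hS' : (⋃ s ∈ S, s.1) = a.1 := hS
    have hb' : b.1 ⊆ a.1 := hb
    change (⋃ s ∈ (fun s => s ⊓ b) '' S, s.1) = b.1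
    rw [biUnion_image]
    change (⋃ s ∈ S, s.1 ∩ b.1) = b.1
    rw [← iUnion₂_inter, hS', inter_eq_right.2 hb']

variable [TopologicalSpace X]

/-- The ideal of `B` corresponding to an open set `U`, namely `{b ∈ B | b ⊆ U}`. -/
def idealOfOpen (B : SetSemilattice X) (U : Opens X) : B.joinCoverage.Ideal :=
  ⟨{b | b.1 ⊆ (U : Set X)}, fun _ _ hab ha => Subset.trans hab ha, fun a S hS hSI => by
    change a.1 ⊆ (U : Set X)
    rw [← show (⋃ s ∈ S, s.1) = a.1 from hS]
    exact iUnion₂_subset fun s hs => hSI hs⟩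

/-- The sublocale of the topology of `X` obtained by imposing the relations `C'` on `B`: the
frame of ideals for the union of the join coverage of `B` with `C'`. -/
abbrev RelationSublocale (B : SetSemilattice X) (C' : SiteCoverage B.Elem) : Type _ :=
  (B.joinCoverage.union C').Ideal

/-- The quotient map from the open sets of `X` onto the sublocale. -/
def toSublocale (B : SetSemilattice X) (C' : SiteCoverage B.Elem) (U : Opens X) :
    B.RelationSublocale C' :=
  SiteCoverage.nucleus B.joinCoverage C' (B.idealOfOpen U)

/-- The subspace of `X` cut out by the relations: the points `x` of `X` whose associated frame
homomorphism `U ↦ [x ∈ U]` has the form `p ∘ f`, where `f` is the quotient map onto the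
sublocale and `p` is a point of the sublocale. -/
def relationSubspace (B : SetSemilattice X) (C' : SiteCoverage B.Elem) : Set X :=
  {x | ∃ p : FrameHom (B.RelationSublocale C') Prop,
    ∀ U : Opens X, p (B.toSublocale C' U) ↔ x ∈ U}

end SetSemilattice

/-! ## The patch topology -/

/-- The coarsest topology containing the topology `t` and all complements of sets that are compact
and saturated (i.e. equal to the intersection of their open supersets) for `t`. -/
@[reducible] def patchTopology {X : Type*} (t : TopologicalSpace X) : TopologicalSpace X :=
  t ⊓ generateFrom {W | ∃ K : Set X, @IsCompact X t K ∧ K = ⋂₀ {U | IsOpen[t] U ∧ K ⊆ U} ∧ W = Kᶜ}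

/-! ## Topological graphs and their path spaces -/

/-- A topological graph with vertex space `E₀` and edge space `E₁` (both are taken to be locally
compact Hausdorff wherever this structure is used below). -/
structure TopologicalGraph (E₀ E₁ : Type*) [TopologicalSpace E₀] [TopologicalSpace E₁] where
  r : E₁ → E₀
  d : E₁ → E₀
  continuous_r : Continuous r
  isLocalHomeomorph_d : IsLocalHomeomorph d

namespace TopologicalGraph

variable {E₀ E₁ : Type*} [TopologicalSpace E₀] [TopologicalSpace E₁] (G : TopologicalGraph E₀ E₁)

/-- Vertices outside the closure of `r(E¹)`. -/
def sources : Set E₀ := (closure (range G.r))ᶜ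

/-- Vertices having a neighbourhood with compact preimage under `r`. -/
def finiteReceivers : Set E₀ := {v | ∃ V ∈ 𝓝 v, IsCompact (G.r ⁻¹' V)}

def regularVertices : Set E₀ := G.finiteReceivers \ closure G.sources

def singularVertices : Set E₀ := G.regularVerticesᶜ

/-- Paths of length `n`, written `(v, e₁, …, eₙ)` with `v = r(e₁)` if `n ≥ 1`. -/
def FinPath (n : ℕ) : Type _ :=
  {x : E₀ × (Fin n → E₁) // (∀ h : 0 < n, G.r (x.2 ⟨0, h⟩) = x.1) ∧
    ∀ (i : ℕ) (h : i + 1 < n), G.d (x.2 ⟨i, by lia⟩) = G.r (x.2 ⟨i + 1, h⟩)}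

instance (n : ℕ) : TopologicalSpace (G.FinPath n) := instTopologicalSpaceSubtype

/-- Infinite paths. -/
def InfPath : Type _ := {e : ℕ → E₁ // ∀ i, G.d (e i) = G.r (e (i + 1))}

variable {G}

/-- The domain of a finite path: `d` of the last edge, or the vertex itself in length `0`. -/
def FinPath.dom : {n : ℕ} → G.FinPath n → E₀
  | 0, μ => μ.1.1
  | n + 1, μ => G.d (μ.1.2 (Fin.last n))

/-- The prefix of length `n` of a finite path. -/
def FinPath.take {m : ℕ} (μ : G.FinPath m) (n : ℕ) (h : n ≤ m) : G.FinPath n :=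
  ⟨(μ.1.1, fun i => μ.1.2 (Fin.castLE h i)),
    fun h0 => μ.2.1 (lt_of_lt_of_le h0 h), fun i hi => μ.2.2 i (lt_of_lt_of_le hi h)⟩

/-- The prefix of length `n` of an infinite path. -/
def InfPath.take (ξ : G.InfPath) (n : ℕ) : G.FinPath n :=
  ⟨(G.r (ξ.1 0), fun i => ξ.1 i), fun _ => rfl, fun i _ => ξ.2 i⟩

variable (G)

/-- The set of all paths, finite or infinite. -/
inductive PathSpace : Type _
  | fin (n : ℕ) (μ : G.FinPath n) : PathSpace
  | inf (ξ : G.InfPath) : PathSpace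

variable {G}

/-- The cylinder set `Z(A)` of `A ⊆ Eⁿ`: all paths with a prefix of length `n` in `A`. -/
def cyl {n : ℕ} (A : Set (G.FinPath n)) : Set G.PathSpace :=
  {x | match x with
    | .fin m μ => ∃ h : n ≤ m, μ.take n h ∈ A
    | .inf ξ => ξ.take n ∈ A}

/-- The cylinder set of a set of finite paths of possibly varying lengths. -/
def cylStar (K : Set (Σ n, G.FinPath n)) : Set G.PathSpace :=
  ⋃ n, cyl (Sigma.mk n ⁻¹' K)

variable (G)

/-- The topology generated by the open cylinder sets. -/
@[reducible] def cylTopology : TopologicalSpace G.PathSpace :=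
  generateFrom {W | ∃ (n : ℕ) (U : Set (G.FinPath n)), IsOpen U ∧ W = cyl U}

/-- The path space carries the patch topology of the cylinder topology. -/
instance : TopologicalSpace G.PathSpace := patchTopology G.cylTopology

/-- The boundary path space. -/
def boundaryPathSpace : Set G.PathSpace :=
  {x | ∃ (n : ℕ) (μ : G.FinPath n), x = .fin n μ ∧ μ.dom ∈ G.singularVertices} ∪
    range PathSpace.inf

variable {G}

/-- The set `(U × B) ∩ Eⁿ⁺¹` for `U ⊆ Eⁿ` and `B ⊆ E¹`. -/
def extend {n : ℕ} (U : Set (G.FinPath n)) (B : Set E₁) : Set (G.FinPath (n + 1)) :=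
  {ν | ν.take n n.le_succ ∈ U ∧ ν.1.2 (Fin.last n) ∈ B}

/-! ### Auxiliary facts -/

theorem mem_cyl_fin {n m : ℕ} {A : Set (G.FinPath n)} {μ : G.FinPath m} :
    PathSpace.fin m μ ∈ cyl A ↔ ∃ h : n ≤ m, μ.take n h ∈ A := Iff.rfl

theorem mem_cyl_inf {n : ℕ} {A : Set (G.FinPath n)} {ξ : G.InfPath} :
    PathSpace.inf ξ ∈ cyl A ↔ ξ.take n ∈ A := Iff.rfl

theorem cyl_inter_cyl {n m : ℕ} (h : n ≤ m) (U : Set (G.FinPath n)) (V : Set (G.FinPath m)) :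
    cyl U ∩ cyl V = cyl {ν | ν ∈ V ∧ ν.take n h ∈ U} := by
  ext x
  cases x with
  | fin k μ =>
    simp only [mem_inter_iff, mem_cyl_fin]
    constructor
    · rintro ⟨⟨_, h1⟩, ⟨h', h2⟩⟩
      exact ⟨h', h2, h1⟩
    · rintro ⟨h', h2, h1⟩
      exact ⟨⟨h.trans h', h1⟩, ⟨h', h2⟩⟩
  | inf ξ =>
    simp only [mem_inter_iff, mem_cyl_inf]
    exact and_comm

theorem cylStar_union (K L : Set (Σ n, G.FinPath n)) :
    cylStar (K ∪ L) = cylStar K ∪ cylStar L := by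
  ext x
  cases x <;>
    simp only [cylStar, mem_iUnion, mem_union, mem_cyl_fin, mem_cyl_inf, mem_preimage] <;> grind

theorem cyl_mono {n : ℕ} {A A' : Set (G.FinPath n)} (h : A ⊆ A') : cyl A ⊆ cyl A' := by
  intro x hx
  cases x with
  | fin k μ => exact ⟨hx.1, h hx.2⟩
  | inf ξ => exact h hx

theorem continuous_take {n m : ℕ} (h : n ≤ m) :
    Continuous fun μ : G.FinPath m => μ.take n h := by
  refine Continuous.subtype_mk ?_ _
  have : Continuous fun μ : G.FinPath m => μ.1 := continuous_subtype_val
  fun_prop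

theorem isOpen_extend {n : ℕ} {U : Set (G.FinPath n)} (hU : IsOpen U) {B : Set E₁}
    (hB : IsOpen B) : IsOpen (extend U B) := by
  have h1 : Continuous fun ν : G.FinPath (n + 1) => ν.1.2 (Fin.last n) := by
    have : Continuous fun μ : G.FinPath (n + 1) => μ.1 := continuous_subtype_val
    fun_prop
  exact (hU.preimage (continuous_take n.le_succ)).inter (hB.preimage h1)

/-- A path followed by an edge. -/
def FinPath.snoc {n : ℕ} (μ : G.FinPath n) (e : E₁) (h : μ.dom = G.r e) : G.FinPath (n + 1) :=
  ⟨(μ.1.1, Fin.snoc (α := fun _ => E₁) μ.1.2 e), by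
    cases n with
    | zero =>
      refine ⟨fun _ => ?_, fun i hi => by lia⟩
      have : (⟨0, by lia⟩ : Fin 1) = Fin.last 0 := rfl
      simp only [this, Fin.snoc_last]
      exact h.symm
    | succ n =>
      refine ⟨fun _ => ?_, fun i hi => ?_⟩
      · have : (⟨0, by lia⟩ : Fin (n + 2)) = Fin.castSucc ⟨0, by lia⟩ := rfl
        simp only [this, Fin.snoc_castSucc]
        exact μ.2.1 (by lia)
      · have h1 : (⟨i, by lia⟩ : Fin (n + 2)) = Fin.castSucc ⟨i, by lia⟩ := rfl
        simp only [h1, Fin.snoc_castSucc]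
        by_cases hin : i = n
        · subst hin
          have h2 : (⟨i + 1, by lia⟩ : Fin (i + 2)) = Fin.last (i + 1) := rfl
          simp only [h2, Fin.snoc_last]
          exact h
        · have h2 : (⟨i + 1, by lia⟩ : Fin (n + 2)) = Fin.castSucc ⟨i + 1, by lia⟩ := rfl
          simp only [h2, Fin.snoc_castSucc]
          exact μ.2.2 i (by lia)⟩

theorem FinPath.dom_take {n : ℕ} (ν : G.FinPath (n + 1)) :
    (ν.take n n.le_succ).dom = G.r (ν.1.2 (Fin.last n)) := by
  cases n with
  | zero => exact (ν.2.1 (by lia)).symm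
  | succ n => exact ν.2.2 n (by lia)

theorem FinPath.snoc_take {n : ℕ} (ν : G.FinPath (n + 1)) :
    (ν.take n n.le_succ).snoc (ν.1.2 (Fin.last n)) ν.dom_take = ν := by
  refine Subtype.ext (Prod.ext rfl (funext fun i => ?_))
  change Fin.snoc (α := fun _ => E₁) (fun i => ν.1.2 (Fin.castLE n.le_succ i))
    (ν.1.2 (Fin.last n)) i = ν.1.2 i
  refine Fin.lastCases ?_ (fun j => ?_) i
  · simp
  · simp only [Fin.snoc_castSucc]
    rfl

theorem FinPath.dom_snoc {n : ℕ} (μ : G.FinPath n) (e : E₁) (h : μ.dom = G.r e) :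
    (μ.snoc e h).dom = G.d e := by
  change G.d (Fin.snoc (α := fun _ => E₁) μ.1.2 e (Fin.last n)) = G.d e
  rw [Fin.snoc_last]

theorem continuous_snoc (n : ℕ) : Continuous
    fun q : {q : G.FinPath n × E₁ // q.1.dom = G.r q.2} => q.1.1.snoc q.1.2 q.2 := by
  refine Continuous.subtype_mk ?_ _
  have h1 : Continuous fun q : {q : G.FinPath n × E₁ // q.1.dom = G.r q.2} => q.1.1.1 :=
    continuous_subtype_val.comp (continuous_fst.comp continuous_subtype_val)
  refine h1.fst.prodMk (continuous_pi fun i => ?_)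
  refine Fin.lastCases ?_ (fun j => ?_) i
  · simp only [Fin.snoc_last]
    fun_prop
  · simp only [Fin.snoc_castSucc]
    fun_prop

theorem isOpenMap_dom (n : ℕ) : IsOpenMap fun μ : G.FinPath n => μ.dom := by
  induction n with
  | zero =>
    intro U hU
    let g : E₀ → G.FinPath 0 := fun v =>
      ⟨(v, Fin.elim0), fun h => absurd h (lt_irrefl 0), fun i h => absurd h (by lia)⟩
    have hg : Continuous g :=
      Continuous.subtype_mk (continuous_id.prodMk continuous_const) _
    have : (fun μ : G.FinPath 0 => μ.dom) '' U = g ⁻¹' U := by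
      have hgd : ∀ μ : G.FinPath 0, g μ.dom = μ := fun μ =>
        Subtype.ext (Prod.ext rfl (funext fun i => i.elim0))
      ext v
      constructor
      · rintro ⟨μ, hμ, rfl⟩
        change g μ.dom ∈ U
        rwa [hgd]
      · exact fun hv => ⟨g v, hv, rfl⟩
    rw [this]
    exact hU.preimage hg
  | succ n ih =>
    intro U hU
    rw [isOpen_iff_mem_nhds]
    rintro _ ⟨ν, hν, rfl⟩
    obtain ⟨O, hO, hOU⟩ := isOpen_induced_iff.1 (hU.preimage (continuous_snoc n))
    have hmem : (ν.take n n.le_succ, ν.1.2 (Fin.last n)) ∈ O := by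
      have : (⟨(ν.take n n.le_succ, ν.1.2 (Fin.last n)), ν.dom_take⟩ :
          {q : G.FinPath n × E₁ // q.1.dom = G.r q.2}) ∈ Subtype.val ⁻¹' O := by
        rw [hOU]
        change (ν.take n n.le_succ).snoc (ν.1.2 (Fin.last n)) ν.dom_take ∈ U
        rwa [ν.snoc_take]
      exact this
    obtain ⟨O₁, O₂, hO₁, hO₂, h1, h2, hsub⟩ := isOpen_prod_iff.1 hO _ _ hmem
    have hW : IsOpen (G.d '' (O₂ ∩ G.r ⁻¹' ((fun μ : G.FinPath n => μ.dom) '' O₁))) :=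
      G.isLocalHomeomorph_d.isOpenMap _ (hO₂.inter ((ih _ hO₁).preimage G.continuous_r))
    refine Filter.mem_of_superset (hW.mem_nhds ⟨_, ⟨h2, ⟨_, h1, ν.dom_take⟩⟩, rfl⟩) ?_
    rintro _ ⟨e, ⟨he, μ, hμ, hμe⟩, rfl⟩
    refine ⟨μ.snoc e hμe, ?_, μ.dom_snoc e hμe⟩
    have : (⟨(μ, e), hμe⟩ : {q : G.FinPath n × E₁ // q.1.dom = G.r q.2}) ∈
        Subtype.val ⁻¹' O := hsub ⟨hμ, he⟩
    rw [hOU] at this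
    exact this

/-! ### The basis and the coverage -/

variable (G)

/-- The sets `Z(U) ∩ Z(K)ᶜ` with `U ⊆ Eⁿ` open and `K ⊆ E*` compact for the disjoint union
topology on `E*`. The empty set is the case `U = ∅`. -/
def basis : SetSemilattice G.PathSpace where
  sets := {a | ∃ (n : ℕ) (U : Set (G.FinPath n)) (K : Set (Σ n, G.FinPath n)),
    IsOpen U ∧ IsCompact K ∧ a = cyl U ∩ (cylStar K)ᶜ}
  inter_mem := by
    have key : ∀ (n m : ℕ) (U : Set (G.FinPath n)) (V : Set (G.FinPath m)), IsOpen U → IsOpen V →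
        ∃ (k : ℕ) (W : Set (G.FinPath k)), IsOpen W ∧ cyl U ∩ cyl V = cyl W := by
      intro n m U V hU hV
      rcases le_total n m with h | h
      · exact ⟨m, _, hV.inter (hU.preimage (continuous_take h)), cyl_inter_cyl h U V⟩
      · exact ⟨n, _, hU.inter (hV.preimage (continuous_take h)),
          (inter_comm _ _).trans (cyl_inter_cyl h V U)⟩
    rintro _ _ ⟨n, U, K, hU, hK, rfl⟩ ⟨m, V, L, hV, hL, rfl⟩
    obtain ⟨k, W, hW, hUV⟩ := key n m U V hU hV
    refine ⟨k, W, K ∪ L, hW, hK.union hL, ?_⟩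
    rw [inter_inter_inter_comm, hUV, cylStar_union, compl_union]

/-- A continuation covering of `A ⊆ E⁰`, as the finite family of its sets `Bᵢ`: open, relatively
compact sets of edges on which `d` is a homeomorphism onto its image and whose union is
`r⁻¹(A)`. It is only defined for an open subset `A` of `r(E¹)`. -/
def IsContinuationCovering (A : Set E₀) (𝓑 : Set (Set E₁)) : Prop :=
  IsOpen A ∧ A ⊆ range G.r ∧ 𝓑.Finite ∧
    (∀ B ∈ 𝓑, IsOpen B ∧ IsCompact (closure B) ∧ IsEmbedding (B.domRestrict G.d)) ∧
    G.r ⁻¹' A = ⋃₀ 𝓑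

variable {G}

/-- The families `{∅, Z((U × B₁) ∩ Eⁿ⁺¹) ∩ Z(K)ᶜ, …, Z((U × Bₖ) ∩ Eⁿ⁺¹) ∩ Z(K)ᶜ}` for a
presentation `a = Z(U) ∩ Z(K)ᶜ` and a continuation covering `B₁, …, Bₖ` of `d(U)`. -/
def IsContinuationFamily (a : Set G.PathSpace) (S : Set (Set G.PathSpace)) : Prop :=
  ∃ (n : ℕ) (U : Set (G.FinPath n)) (K : Set (Σ n, G.FinPath n)) (𝓑 : Set (Set E₁)),
    IsOpen U ∧ IsCompact K ∧ a = cyl U ∩ (cylStar K)ᶜ ∧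
    G.IsContinuationCovering (FinPath.dom '' U) 𝓑 ∧
    S = insert ∅ ((fun B => cyl (extend U B) ∩ (cylStar K)ᶜ) '' 𝓑)

/-- The families `{∅} ∪ {Z(U') ∩ Z(K)ᶜ | U' ∈ 𝓤}` for a presentation `a = Z(U) ∩ Z(K)ᶜ` and a
family `𝓤` of open subsets of `Eⁿ` with union `U`. -/
def IsTopologicalFamily (a : Set G.PathSpace) (S : Set (Set G.PathSpace)) : Prop :=
  ∃ (n : ℕ) (U : Set (G.FinPath n)) (K : Set (Σ n, G.FinPath n)) (𝓤 : Set (Set (G.FinPath n))),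
    IsOpen U ∧ IsCompact K ∧ a = cyl U ∩ (cylStar K)ᶜ ∧
    (∀ U' ∈ 𝓤, IsOpen U') ∧ U = ⋃₀ 𝓤 ∧
    S = insert ∅ ((fun U' => cyl U' ∩ (cylStar K)ᶜ) '' 𝓤)

/-- Every set `Z(V) ∩ Z(L)ᶜ` can be presented so that `V` itself avoids `Z(L)`. -/
theorem exists_normalized [T2Space E₀] [T2Space E₁] {m : ℕ} {V : Set (G.FinPath m)}
    {L : Set (Σ n, G.FinPath n)} (hV : IsOpen V) (hL : IsCompact L) :
    ∃ V' : Set (G.FinPath m), IsOpen V' ∧ cyl V ∩ (cylStar L)ᶜ = cyl V' ∩ (cylStar L)ᶜ ∧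
      ∀ ν ∈ V', PathSpace.fin m ν ∈ cyl V ∩ (cylStar L)ᶜ := by
  have : ∀ k, T2Space (G.FinPath k) := fun k =>
    inferInstanceAs (T2Space {x : E₀ × (Fin k → E₁) // _})
  have hLk : ∀ k, IsClosed (Sigma.mk k ⁻¹' L) := fun k =>
    hL.isClosed.preimage continuous_sigmaMk
  refine ⟨{ν | ν ∈ V ∧ ∀ k : Fin (m + 1), ν.take k (Nat.lt_succ_iff.1 k.2) ∉ Sigma.mk k.1 ⁻¹' L},
    ?_, ?_, ?_⟩
  · have : IsOpen (⋂ k : Fin (m + 1), {ν : G.FinPath m |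
        ν.take k (Nat.lt_succ_iff.1 k.2) ∉ Sigma.mk k.1 ⁻¹' L}) :=
      isOpen_iInter_of_finite fun k =>
        (hLk k).isOpen_compl.preimage (continuous_take (Nat.lt_succ_iff.1 k.2))
    convert hV.inter this using 1
    ext ν
    simp
  · apply subset_antisymm
    · rintro x ⟨hx, hxL⟩
      refine ⟨?_, hxL⟩
      cases x with
      | fin k μ =>
        obtain ⟨h, hμ⟩ := hx
        exact ⟨h, hμ, fun j hj => hxL (mem_iUnion.2 ⟨j, (Nat.lt_succ_iff.1 j.2).trans h, hj⟩)⟩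
      | inf ξ => exact ⟨hx, fun j hj => hxL (mem_iUnion.2 ⟨j, hj⟩)⟩
    · exact inter_subset_inter_left _ (cyl_mono fun ν hν => hν.1)
  · rintro ν ⟨hν, hk⟩
    refine ⟨⟨le_rfl, hν⟩, fun h => ?_⟩
    obtain ⟨k, hkm, hmem⟩ := mem_iUnion.1 h
    exact hk ⟨k, Nat.lt_succ_iff.2 hkm⟩ hmem

/-- Intersecting with `Z(V) ∩ Z(L)ᶜ` turns a family of cylinders over shorter paths that cover
`V` into a topological covering. -/
theorem isTopologicalFamily_inter {p m : ℕ} (h : p ≤ m) {V : Set (G.FinPath m)}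
    {K L : Set (Σ n, G.FinPath n)} (hV : IsOpen V) (hL : IsCompact L) {b : Set G.PathSpace}
    (hb : b = cyl V ∩ (cylStar L)ᶜ) (hbK : b ⊆ (cylStar K)ᶜ) {𝓦 : Set (Set (G.FinPath p))}
    (h𝓦 : ∀ W ∈ 𝓦, IsOpen W) (hcov : ∀ ν ∈ V, ∃ W ∈ 𝓦, ν.take p h ∈ W) :
    IsTopologicalFamily b ((fun s => s ∩ b) ''
      insert ∅ ((fun W => cyl W ∩ (cylStar K)ᶜ) '' 𝓦)) := by
  refine ⟨m, V, L, (fun W => {ν | ν ∈ V ∧ ν.take p h ∈ W}) '' 𝓦, hV, hL, hb, ?_, ?_, ?_⟩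
  · rintro _ ⟨W, hW, rfl⟩
    exact hV.inter ((h𝓦 W hW).preimage (continuous_take h))
  · apply subset_antisymm
    · intro ν hν
      obtain ⟨W, hW, hνW⟩ := hcov ν hν
      exact ⟨_, ⟨W, hW, rfl⟩, hν, hνW⟩
    · rintro ν ⟨_, ⟨W, _, rfl⟩, hν, _⟩
      exact hν
  · rw [image_insert_eq, empty_inter, image_image, image_image]
    congr 1
    refine image_congr fun W _ => ?_
    rw [inter_assoc, inter_eq_right.2 hbK, ← cyl_inter_cyl h, hb, inter_assoc]

/-- Restricting a continuation covering. -/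
theorem IsContinuationCovering.mono {A A' : Set E₀} {𝓑 : Set (Set E₁)}
    (h : G.IsContinuationCovering A 𝓑) (hA' : IsOpen A') (hsub : A' ⊆ A) :
    G.IsContinuationCovering A' ((fun B => B ∩ G.r ⁻¹' A') '' 𝓑) := by
  obtain ⟨_, hr, hfin, hB, hU⟩ := h
  refine ⟨hA', hsub.trans hr, hfin.image _, ?_, ?_⟩
  · rintro _ ⟨B, hB', rfl⟩
    obtain ⟨h1, h2, h3⟩ := hB B hB'
    refine ⟨h1.inter (hA'.preimage G.continuous_r),
      h2.of_isClosed_subset isClosed_closure (closure_mono inter_subset_left), ?_⟩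
    exact h3.comp (IsEmbedding.inclusion inter_subset_left)
  · rw [sUnion_image, ← iUnion₂_inter, ← sUnion_eq_biUnion, ← hU]
    exact (inter_eq_right.2 (preimage_mono hsub)).symm

theorem cyl_extend_subset {n : ℕ} (U : Set (G.FinPath n)) (B : Set E₁) :
    cyl (extend U B) ⊆ cyl U := by
  intro x hx
  cases x with
  | fin k μ => exact ⟨(Nat.le_succ n).trans hx.1, hx.2.1⟩
  | inf ξ => exact hx.1

theorem meet_stable_aux [T2Space E₀] [T2Space E₁] {a b : Set G.PathSpace}
    (hb : b ∈ G.basis.sets) (hba : b ⊆ a) {S : Set (Set G.PathSpace)}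
    (hS : IsContinuationFamily a S ∨ IsTopologicalFamily a S) :
    IsContinuationFamily b ((fun s => s ∩ b) '' S) ∨
      IsTopologicalFamily b ((fun s => s ∩ b) '' S) := by
  obtain ⟨m, V₀, L, hV₀, hL, rfl⟩ := hb
  obtain ⟨V, hV, hVeq, hVb⟩ := exists_normalized hV₀ hL
  rw [hVeq] at hba hVb ⊢
  rcases V.eq_empty_or_nonempty with hVe | ⟨ν₀, hν₀⟩
  · have hbe : cyl V ∩ (cylStar L)ᶜ = ∅ := by
      rw [hVe, eq_empty_iff_forall_notMem]
      rintro (⟨k, μ⟩ | ξ) hx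
      · exact hx.1.2
      · exact hx.1
    have hSne : S.Nonempty := by
      rcases hS with ⟨_, _, _, _, _, _, _, _, rfl⟩ | ⟨_, _, _, _, _, _, _, _, _, rfl⟩ <;>
        exact insert_nonempty _ _
    right
    refine ⟨m, V, L, ∅, hV, hL, rfl, by simp, by simp [hVe], ?_⟩
    rw [hbe]
    simp [hSne]
  rcases hS with ⟨n, U, K, 𝓑, hU, hK, rfl, h𝓑, rfl⟩ | ⟨n, U, K, 𝓤, hU, hK, rfl, h𝓤, hUeq, rfl⟩
  · have hnm : n ≤ m := (hba (hVb ν₀ hν₀)).1.1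
    have hVU : ∀ ν ∈ V, ν.take n hnm ∈ U := fun ν hν => (hba (hVb ν hν)).1.2
    rcases hnm.eq_or_lt with rfl | hlt
    · left
      have hVU' : V ⊆ U := fun ν hν => hVU ν hν
      refine ⟨n, V, L, _, hV, hL, rfl,
        h𝓑.mono (isOpenMap_dom n V hV) (image_mono hVU'), ?_⟩
      rw [image_insert_eq, empty_inter, image_image, image_image]
      congr 1
      refine image_congr fun B _ => ?_
      rw [inter_assoc, inter_eq_right.2 (hba.trans inter_subset_right), ← inter_assoc]
      congr 1
      rw [inter_comm, cyl_inter_cyl n.le_succ]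
      congr 1
      ext ν
      constructor
      · rintro ⟨⟨_, h2⟩, h3⟩
        exact ⟨h3, h2, ⟨_, h3, ν.dom_take⟩⟩
      · rintro ⟨h3, h2, _⟩
        exact ⟨⟨hVU' h3, h2⟩, h3⟩
    · right
      have := isTopologicalFamily_inter (K := K) (𝓦 := extend U '' 𝓑) hlt hV hL rfl
        (hba.trans inter_subset_right)
        (by
          rintro _ ⟨B, hB, rfl⟩
          exact isOpen_extend hU (h𝓑.2.2.2.1 B hB).1)
        (by
          intro ν hν
          have hr : (ν.take (n + 1) hlt).1.2 (Fin.last n) ∈ ⋃₀ 𝓑 := by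
            rw [← h𝓑.2.2.2.2]
            exact ⟨_, hVU ν hν, (ν.take (n + 1) hlt).dom_take⟩
          obtain ⟨B, hB, hBmem⟩ := hr
          exact ⟨_, ⟨B, hB, rfl⟩, hVU ν hν, hBmem⟩)
      rwa [image_image] at this
  · right
    have hnm : n ≤ m := (hba (hVb ν₀ hν₀)).1.1
    refine isTopologicalFamily_inter hnm hV hL rfl (hba.trans inter_subset_right) h𝓤 ?_
    intro ν hν
    have : ν.take n hnm ∈ U := (hba (hVb ν hν)).1.2
    rw [hUeq] at this
    exact this

variable (G)

/-- The coverage on the basis given by the continuation coverings and the topological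
coverings. -/
def relations [T2Space E₀] [T2Space E₁] : SiteCoverage G.basis.Elem where
  covers a := {S | IsContinuationFamily a.1 (Subtype.val '' S) ∨
    IsTopologicalFamily a.1 (Subtype.val '' S)}
  le_of_mem := by
    intro a S hS s hs
    change s.1 ⊆ a.1
    have hs' : s.1 ∈ Subtype.val '' S := ⟨s, hs, rfl⟩
    rcases hS with ⟨n, U, K, 𝓑, -, -, ha, -, hS⟩ | ⟨n, U, K, 𝓤, -, -, ha, -, hU, hS⟩
    · rw [hS] at hs'
      rw [ha]
      rcases hs' with h | ⟨B, _, h⟩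
      · rw [h]
        exact empty_subset _
      · rw [← h]
        exact inter_subset_inter_left _ (cyl_extend_subset U B)
    · rw [hS] at hs'
      rw [ha]
      rcases hs' with h | ⟨U', hU', h⟩
      · rw [h]
        exact empty_subset _
      · rw [← h]
        refine inter_subset_inter_left _ (cyl_mono ?_)
        rw [hU]
        exact subset_sUnion_of_mem hU'
  meet_stable := by
    intro a S hS b hba
    have := meet_stable_aux b.2 hba hS
    have himg : (Subtype.val '' ((fun s : G.basis.Elem => s ⊓ b) '' S) : Set (Set G.PathSpace)) =
        (fun s => s ∩ b.1) '' (Subtype.val '' S) := by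
      rw [image_image, image_image]
      rfl
    change IsContinuationFamily b.1 (Subtype.val '' ((fun s : G.basis.Elem => s ⊓ b) '' S)) ∨
      IsTopologicalFamily b.1 (Subtype.val '' ((fun s : G.basis.Elem => s ⊓ b) '' S))
    rw [himg]
    exact this

end TopologicalGraph

/-!
A point of the sublocale `G` is the same thing as a point `x` of `X` which *respects* the imposed
coverings: whenever `x ∈ a` and `S` is a covering of `a`, some member of `S` contains `x`. This
holds for any relations on any basis of any space (`SetSemilattice.mem_relationSubspace_iff`): a
frame homomorphism on ideals turns the covering `S` of `a` into a finite or infinite disjunction,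
and conversely the ideals that contain a neighbourhood of a respecting point `x` define a frame
homomorphism to `Prop`.

To apply this, the sets `Z(U) ∩ Z(K)ᶜ` have to form a basis of the patch topology
(`TopologicalGraph.isTopologicalBasis_basis`). They are open since `Z(K)` is the intersection of
the cylinder-open neighbourhoods of the compact set `K` of finite paths, hence compact and
saturated. They are fine enough since a compact set inside a cylinder-open set `W` is covered by
finitely many cylinders `Z(Kᵢ) ⊆ W` over compact sets `Kᵢ`, as each `Eⁿ` is locally compact.

It remains to find the paths that respect the coverings. Every path respects the topological ones.
A path in `Z(U)` that is longer than the members of `U` respects a continuation covering over `U`,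
because its next edge lies in `r⁻¹(d(U))`; a path in `U` itself never does. So `x` fails to respect
some covering exactly if `x` is a finite path whose domain has an open neighbourhood with a
continuation covering, and such neighbourhoods exist exactly at the regular vertices
(`TopologicalGraph.mem_regularVertices_iff`).
-/

/-! ### Points of the sublocale given by relations -/

namespace SetSemilattice

variable {X : Type*} {B : SetSemilattice X} {C' : SiteCoverage B.Elem}

/-- For a point `x` that respects all the relations, the largest ideal whose members contain `x`
only if `P` holds. -/
def pointIdeal {x : X} (h : ∀ a : B.Elem, ∀ S ∈ C'.covers a, x ∈ a.1 → ∃ s ∈ S, x ∈ s.1)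
    (P : Prop) : B.RelationSublocale C' :=
  ⟨{b | x ∈ b.1 → P}, fun _ _ hcb hb hxc => hb (hcb hxc), by
    rintro a S (hS | hS) hSI hxa
    · rw [← show (⋃ s ∈ S, s.1) = a.1 from hS] at hxa
      obtain ⟨s, hs, hxs⟩ := mem_iUnion₂.1 hxa
      exact hSI hs hxs
    · obtain ⟨s, hs, hxs⟩ := h a S hS hxa
      exact hSI hs hxs⟩

/-- The point of the sublocale given by a point `x` that respects all the relations: it sends an
ideal to the truth value of "some member contains `x`". -/
def pointHom (C' : SiteCoverage B.Elem) (x : X) (hx : ∃ b : B.Elem, x ∈ b.1)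
    (h : ∀ a : B.Elem, ∀ S ∈ C'.covers a, x ∈ a.1 → ∃ s ∈ S, x ∈ s.1) :
    FrameHom (B.RelationSublocale C') Prop where
  toFun I := ∃ b ∈ I.1, x ∈ b.1
  map_inf' I J := by
    refine propext ⟨fun ⟨b, hb, hxb⟩ => ?_, fun ⟨⟨b, hb, hxb⟩, c, hc, hxc⟩ => ?_⟩
    · exact ⟨⟨b, (inf_le_left : I ⊓ J ≤ I) hb, hxb⟩, b, (inf_le_right : I ⊓ J ≤ J) hb, hxb⟩
    · let M : B.RelationSublocale C' := ⟨I.1 ∩ J.1, I.2.1.inter J.2.1, fun a S hS hSI =>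
        ⟨I.2.2 a S hS fun s hs => (hSI hs).1, J.2.2 a S hS fun s hs => (hSI hs).2⟩⟩
      have hM : M ≤ I ⊓ J := le_inf (fun _ h => h.1) (fun _ h => h.2)
      exact ⟨b ⊓ c, hM ⟨I.2.1 inf_le_left hb, J.2.1 inf_le_right hc⟩, hxb, hxc⟩
  map_top' := by
    obtain ⟨b, hb⟩ := hx
    let M : B.RelationSublocale C' := ⟨univ, isLowerSet_univ, fun _ _ _ _ => mem_univ _⟩
    exact propext ⟨fun _ => trivial, fun _ => ⟨b, (le_top : M ≤ ⊤) (mem_univ b), hb⟩⟩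
  map_sSup' T := by
    rw [sSup_Prop_eq]
    refine propext ⟨fun ⟨b, hb, hxb⟩ => ?_, ?_⟩
    · have hM : sSup T ≤ pointIdeal h (∃ I ∈ T, ∃ c ∈ I.1, x ∈ c.1) :=
        sSup_le fun I hI c hc hxc => ⟨I, hI, c, hc, hxc⟩
      obtain ⟨I, hI, c, hc, hxc⟩ := hM hb hxb
      exact ⟨_, ⟨I, hI, rfl⟩, c, hc, hxc⟩
    · rintro ⟨_, ⟨I, hI, rfl⟩, b, hb, hxb⟩
      exact ⟨b, (le_sSup hI : I ≤ sSup T) hb, hxb⟩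

variable [TopologicalSpace X]

theorem toSublocale_le_iff {U : Opens X} {J : B.RelationSublocale C'} :
    B.toSublocale C' U ≤ J ↔ ∀ b : B.Elem, b.1 ⊆ U → b ∈ J.1 :=
  ⟨fun h _ hb => h (mem_iInter₂.2 fun _ hI => hI hb), fun h => sInf_le (show _ ⊆ J.1 from h)⟩

/-- The subspace cut out by relations consists of the points that respect every relation. -/
theorem mem_relationSubspace_iff (hB : IsTopologicalBasis B.sets) {x : X} :
    x ∈ B.relationSubspace C' ↔
      ∀ a : B.Elem, ∀ S ∈ C'.covers a, x ∈ a.1 → ∃ s ∈ S, x ∈ s.1 := by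
  constructor
  · rintro ⟨p, hp⟩ a S hS hxa
    let o : B.Elem → Opens X := fun b => ⟨b.1, hB.isOpen b.2⟩
    let J : B.RelationSublocale C' := sSup ((fun s => B.toSublocale C' (o s)) '' S)
    have hle : B.toSublocale C' (o a) ≤ J := by
      refine toSublocale_le_iff.2 fun b hb => J.2.1 (show b ≤ a from hb) ?_
      refine J.2.2 a S (Or.inr hS) fun s hs => ?_
      exact toSublocale_le_iff.1 (le_sSup ⟨s, hs, rfl⟩ : B.toSublocale C' (o s) ≤ J) s subset_rfl
    have hp' : p J := OrderHomClass.mono p hle ((hp (o a)).2 hxa)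
    rw [map_sSup, sSup_Prop_eq] at hp'
    obtain ⟨_, ⟨_, ⟨s, hs, rfl⟩, rfl⟩, hps⟩ := hp'
    exact ⟨s, hs, (hp (o s)).1 hps⟩
  · intro h
    obtain ⟨b, hb, hxb, -⟩ := hB.exists_subset_of_mem_open (mem_univ x) isOpen_univ
    refine ⟨pointHom C' x ⟨⟨b, hb⟩, hxb⟩ h, fun U => ⟨fun ⟨c, hc, hxc⟩ => ?_, fun hxU => ?_⟩⟩
    · exact (toSublocale_le_iff (J := pointIdeal h (x ∈ U))).2 (fun b hb hxb => hb hxb) hc hxc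
    · obtain ⟨c, hc, hxc, hcU⟩ := hB.exists_subset_of_mem_open hxU U.2
      exact ⟨⟨c, hc⟩, toSublocale_le_iff.1 le_rfl ⟨c, hc⟩ hcU, hxc⟩

end SetSemilattice

namespace TopologicalGraph

variable {E₀ E₁ : Type*} [TopologicalSpace E₀] [TopologicalSpace E₁] {G : TopologicalGraph E₀ E₁}

/-! ### Spaces of finite paths -/

instance [T2Space E₀] [T2Space E₁] (n : ℕ) : T2Space (G.FinPath n) :=
  inferInstanceAs (T2Space (Subtype _))

instance [T2Space E₀] [LocallyCompactSpace E₀] [LocallyCompactSpace E₁] (n : ℕ) :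
    LocallyCompactSpace (G.FinPath n) := by
  have hr := G.continuous_r
  have hd := G.isLocalHomeomorph_d.continuous
  have hc : IsClosed {x : E₀ × (Fin n → E₁) | (∀ h : 0 < n, G.r (x.2 ⟨0, h⟩) = x.1) ∧
      ∀ (i : ℕ) (h : i + 1 < n), G.d (x.2 ⟨i, by lia⟩) = G.r (x.2 ⟨i + 1, h⟩)} := by
    simp only [ofPred_and, ofPred_forall]
    refine (isClosed_iInter fun h => ?_).inter (isClosed_iInter fun i => isClosed_iInter fun h => ?_)
    · exact isClosed_eq (by fun_prop) (by fun_prop)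
    · exact isClosed_eq (by fun_prop) (by fun_prop)
  exact hc.isClosedEmbedding_subtypeVal.locallyCompactSpace

theorem continuous_dom (n : ℕ) : Continuous fun μ : G.FinPath n => μ.dom := by
  have h : Continuous fun μ : G.FinPath n => μ.1 := continuous_subtype_val
  have hd := G.isLocalHomeomorph_d.continuous
  cases n with
  | zero => exact h.fst
  | succ n => exact hd.comp ((continuous_apply (Fin.last n)).comp h.snd)

/-! ### Cylinder sets -/

theorem mem_cyl_iff_exists {n : ℕ} {A : Set (G.FinPath n)} {x : G.PathSpace} :
    x ∈ cyl A ↔ ∃ ν ∈ A, x ∈ cyl {ν} := by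
  cases x with
  | fin m μ => exact ⟨fun ⟨h, hμ⟩ => ⟨_, hμ, h, rfl⟩, fun ⟨ν, hν, h, hμ⟩ => ⟨h, hμ ▸ hν⟩⟩
  | inf ξ => exact ⟨fun h => ⟨_, h, rfl⟩, fun ⟨ν, hν, hξ⟩ => by
      obtain rfl : ξ.take n = ν := hξ
      exact hν⟩

/-- A path has at most one prefix of each length. -/
theorem eq_of_mem_cyl_singleton {n : ℕ} {ν ν' : G.FinPath n} {x : G.PathSpace}
    (h : x ∈ cyl {ν}) (h' : x ∈ cyl {ν'}) : ν = ν' := by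
  cases x with
  | fin m μ => exact h.2.symm.trans h'.2
  | inf ξ => exact Eq.trans (Eq.symm h) h'

theorem fin_mem_cyl {n : ℕ} {ν : G.FinPath n} {A : Set (G.FinPath n)} :
    PathSpace.fin n ν ∈ cyl A ↔ ν ∈ A := ⟨fun h => h.2, fun h => ⟨le_rfl, h⟩⟩

/-- A cylinder that contains a finite path contains its extensions. -/
theorem mem_cyl_of_mem_cyl_singleton {n m : ℕ} {ν : G.FinPath n} {A : Set (G.FinPath m)}
    {x : G.PathSpace} (hx : x ∈ cyl {ν}) (h : PathSpace.fin n ν ∈ cyl A) : x ∈ cyl A := by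
  obtain ⟨hmn, hν⟩ := h
  cases x with
  | fin k μ =>
    obtain ⟨hnk, hμ⟩ := hx
    obtain rfl : μ.take n hnk = ν := hμ
    exact ⟨hmn.trans hnk, hν⟩
  | inf ξ =>
    obtain rfl : ξ.take n = ν := hx
    exact hν

theorem mem_cyl_univ_zero (x : G.PathSpace) : x ∈ cyl (univ : Set (G.FinPath 0)) := by
  cases x with
  | fin m μ => exact ⟨Nat.zero_le m, mem_univ _⟩
  | inf ξ => exact mem_univ (ξ.take 0)

theorem mem_cylStar_iff {K : Set (Σ n, G.FinPath n)} {x : G.PathSpace} :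
    x ∈ cylStar K ↔ ∃ p ∈ K, x ∈ cyl {p.2} := by
  simp only [cylStar, mem_iUnion, mem_cyl_iff_exists (A := Sigma.mk _ ⁻¹' K)]
  exact ⟨fun ⟨n, ν, hν, hx⟩ => ⟨⟨n, ν⟩, hν, hx⟩, fun ⟨⟨n, ν⟩, hν, hx⟩ => ⟨n, ν, hν, hx⟩⟩

theorem cylStar_empty : cylStar (∅ : Set (Σ n, G.FinPath n)) = ∅ :=
  eq_empty_of_forall_notMem fun _ hx => by
    obtain ⟨p, hp, -⟩ := mem_cylStar_iff.1 hx
    exact hp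

theorem cylStar_image_mk {n : ℕ} (A : Set (G.FinPath n)) :
    cylStar (Sigma.mk n '' A) = cyl A := by
  ext x
  rw [mem_cylStar_iff, mem_cyl_iff_exists]
  exact ⟨fun ⟨_, ⟨ν, hν, h⟩, hx⟩ => by subst h; exact ⟨ν, hν, hx⟩,
    fun ⟨ν, hν, hx⟩ => ⟨_, ⟨ν, hν, rfl⟩, hx⟩⟩

/-! ### The cylinder topology -/

theorem isOpen_cyl {n : ℕ} {U : Set (G.FinPath n)} (hU : IsOpen U) :
    IsOpen[G.cylTopology] (cyl U) := isOpen_generateFrom_of_mem ⟨n, U, hU, rfl⟩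

/-- The open cylinders form a basis of the cylinder topology. -/
theorem exists_cyl_subset {W : Set G.PathSpace} (hW : IsOpen[G.cylTopology] W) {x : G.PathSpace}
    (hx : x ∈ W) : ∃ (n : ℕ) (U : Set (G.FinPath n)), IsOpen U ∧ x ∈ cyl U ∧ cyl U ⊆ W := by
  induction hW with
  | basic W hW =>
    obtain ⟨n, U, hU, rfl⟩ := hW
    exact ⟨n, U, hU, hx, subset_rfl⟩
  | univ => exact ⟨0, univ, isOpen_univ, mem_cyl_univ_zero x, subset_univ _⟩
  | inter W₁ W₂ _ _ ih₁ ih₂ =>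
    obtain ⟨n, U, hU, hxU, hUW⟩ := ih₁ hx.1
    obtain ⟨m, V, hV, hxV, hVW⟩ := ih₂ hx.2
    have hsub := inter_subset_inter hUW hVW
    rcases le_total n m with h | h
    · rw [cyl_inter_cyl h] at hsub
      exact ⟨m, _, hV.inter (hU.preimage (continuous_take h)),
        cyl_inter_cyl h U V ▸ ⟨hxU, hxV⟩, hsub⟩
    · rw [inter_comm, cyl_inter_cyl h] at hsub
      exact ⟨n, _, hU.inter (hV.preimage (continuous_take h)),
        cyl_inter_cyl h V U ▸ ⟨hxV, hxU⟩, hsub⟩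
  | sUnion 𝓦 _ ih =>
    obtain ⟨W, hW, hxW⟩ := hx
    obtain ⟨n, U, hU, hxU, hUW⟩ := ih W hW hxW
    exact ⟨n, U, hU, hxU, hUW.trans (subset_sUnion_of_mem hW)⟩

/-- The inclusion of the finite paths is continuous for the cylinder topology. -/
theorem continuous_fin : @Continuous (Σ n, G.FinPath n) G.PathSpace _ G.cylTopology
    fun p => .fin p.1 p.2 := by
  refine continuous_generateFrom_iff.2 ?_
  rintro _ ⟨n, U, hU, rfl⟩
  refine isOpen_sigma_iff.2 fun m => ?_
  by_cases h : n ≤ m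
  · convert hU.preimage (continuous_take h) using 1
    ext μ
    exact ⟨fun ⟨_, hμ⟩ => hμ, fun hμ => ⟨h, hμ⟩⟩
  · convert isOpen_empty
    exact eq_empty_of_forall_notMem fun μ hμ => h hμ.1

/-- `Z(K)` is the saturation of `K`, the intersection of its neighbourhoods. -/
theorem cylStar_eq_nhdsKer [T2Space E₀] [T2Space E₁] (K : Set (Σ n, G.FinPath n)) :
    cylStar K = @nhdsKer _ G.cylTopology ((fun p => PathSpace.fin p.1 p.2) '' K) := by
  ext x
  rw [@mem_nhdsKer _ G.cylTopology, mem_cylStar_iff]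
  constructor
  · rintro ⟨p, hp, hx⟩ O hO hKO
    obtain ⟨m, U, -, hpU, hUO⟩ := exists_cyl_subset hO (hKO ⟨p, hp, rfl⟩)
    exact hUO (mem_cyl_of_mem_cyl_singleton hx hpU)
  · -- If no member of `K` is a prefix of `x`, then the paths having a prefix that is not a prefix
    -- of `x` form an open set that contains `K` but not `x`.
    intro h
    by_contra hcon
    push Not at hcon
    let U : ∀ n, Set (G.FinPath n) := fun n => {ν | x ∉ cyl {ν}}
    have hU : ∀ n, IsOpen (U n) := fun n => by
      have hs : Set.Subsingleton {ν : G.FinPath n | x ∈ cyl {ν}} := fun ν hν ν' hν' =>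
        eq_of_mem_cyl_singleton hν hν'
      exact hs.isClosed.isOpen_compl
    have hx := h (⋃ n, cyl (U n))
      (@isOpen_iUnion _ _ G.cylTopology _ fun n => isOpen_cyl (hU n)) (by
        rintro _ ⟨p, hp, rfl⟩
        exact mem_iUnion.2 ⟨p.1, fin_mem_cyl.2 (hcon p hp)⟩)
    obtain ⟨n, hn⟩ := mem_iUnion.1 hx
    obtain ⟨ν, hν, hxν⟩ := mem_cyl_iff_exists.1 hn
    exact hν hxν

/-- A compact subset of a cylinder-open set `W` lies in `Z(K) ⊆ W` for some compact set `K` of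
finite paths. -/
theorem exists_cylStar_between [T2Space E₀] [T2Space E₁] [LocallyCompactSpace E₀]
    [LocallyCompactSpace E₁] {Q W : Set G.PathSpace} (hQ : @IsCompact _ G.cylTopology Q)
    (hW : IsOpen[G.cylTopology] W) (hQW : Q ⊆ W) :
    ∃ K : Set (Σ n, G.FinPath n), IsCompact K ∧ Q ⊆ cylStar K ∧ cylStar K ⊆ W := by
  refine @IsCompact.induction_on _ G.cylTopology Q hQ
    (fun Q => ∃ K : Set (Σ n, G.FinPath n), IsCompact K ∧ Q ⊆ cylStar K ∧ cylStar K ⊆ W)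
    ?_ ?_ ?_ ?_
  · exact ⟨∅, isCompact_empty, empty_subset _, cylStar_empty.trans_subset (empty_subset _)⟩
  · rintro s t hst ⟨K, hK, htK, hKW⟩
    exact ⟨K, hK, hst.trans htK, hKW⟩
  · rintro s t ⟨K, hK, hsK, hKW⟩ ⟨L, hL, htL, hLW⟩
    refine ⟨K ∪ L, hK.union hL, ?_, ?_⟩ <;> rw [cylStar_union]
    · exact union_subset_union hsK htL
    · exact union_subset hKW hLW
  · intro x hx
    obtain ⟨n, U, hU, hxU, hUW⟩ := exists_cyl_subset hW (hQW hx)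
    obtain ⟨ν, hν, hxν⟩ := mem_cyl_iff_exists.1 hxU
    obtain ⟨K, hK, hνK, hKU⟩ := exists_compact_subset hU hν
    refine ⟨cyl (interior K), ?_, Sigma.mk n '' K, hK.image continuous_sigmaMk, ?_, ?_⟩
    · refine @mem_nhdsWithin_of_mem_nhds _ G.cylTopology _ _ _ ?_
      exact @IsOpen.mem_nhds _ G.cylTopology _ _ (isOpen_cyl isOpen_interior)
        (mem_cyl_iff_exists.2 ⟨ν, hνK, hxν⟩)
    · rw [cylStar_image_mk]
      exact cyl_mono interior_subset
    · rw [cylStar_image_mk]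
      exact (cyl_mono hKU).trans hUW

/-! ### The basis of the patch topology -/

theorem isOpen_compl_cylStar [T2Space E₀] [T2Space E₁] {K : Set (Σ n, G.FinPath n)}
    (hK : IsCompact K) : IsOpen (cylStar K)ᶜ := by
  have hle : (inferInstance : TopologicalSpace G.PathSpace) ≤ generateFrom _ := inf_le_right
  refine hle _ (isOpen_generateFrom_of_mem ⟨cylStar K, ?_, ?_, rfl⟩)
  · rw [cylStar_eq_nhdsKer, @IsCompact.nhdsKer_iff _ G.cylTopology]
    exact @IsCompact.image _ _ _ G.cylTopology _ _ hK continuous_fin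
  · rw [← @nhdsKer_def _ G.cylTopology, cylStar_eq_nhdsKer, @nhdsKer_nhdsKer _ G.cylTopology]

theorem isTopologicalBasis_basis (G : TopologicalGraph E₀ E₁) [T2Space E₀] [T2Space E₁]
    [LocallyCompactSpace E₀] [LocallyCompactSpace E₁] : IsTopologicalBasis G.basis.sets := by
  have hcyl : ∀ (n : ℕ) (U : Set (G.FinPath n)), IsOpen U → cyl U ∈ G.basis.sets :=
    fun n U hU => ⟨n, U, ∅, hU, isCompact_empty, by simp [cylStar_empty]⟩
  refine isTopologicalBasis_of_isOpen_of_nhds ?_ fun x W hx hW => ?_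
  · rintro _ ⟨n, U, K, hU, hK, rfl⟩
    have hle : (inferInstance : TopologicalSpace G.PathSpace) ≤ G.cylTopology := inf_le_left
    exact (hle _ (isOpen_cyl hU)).inter (isOpen_compl_cylStar hK)
  · change IsOpen[G.cylTopology ⊓ _] W at hW
    rw [← generateFrom_union] at hW
    induction hW with
    | basic W hW =>
      rcases hW with ⟨n, U, hU, rfl⟩ | ⟨Q, hQ, hsat, rfl⟩
      · exact ⟨_, hcyl n U hU, hx, subset_rfl⟩
      · have hx' : x ∉ ⋂₀ {U | IsOpen[G.cylTopology] U ∧ Q ⊆ U} := hsat ▸ hx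
        simp only [mem_sInter, not_forall] at hx'
        obtain ⟨O, ⟨hO, hQO⟩, hxO⟩ := hx'
        obtain ⟨K, hK, hQK, hKO⟩ := exists_cylStar_between hQ hO hQO
        refine ⟨_, ⟨0, univ, K, isOpen_univ, hK, rfl⟩,
          ⟨mem_cyl_univ_zero x, fun h => hxO (hKO h)⟩, ?_⟩
        exact inter_subset_right.trans (compl_subset_compl.2 hQK)
    | univ => exact ⟨_, hcyl 0 univ isOpen_univ, mem_cyl_univ_zero x, subset_univ _⟩
    | inter W₁ W₂ _ _ ih₁ ih₂ =>
      obtain ⟨b, hb, hxb, hbW⟩ := ih₁ hx.1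
      obtain ⟨c, hc, hxc, hcW⟩ := ih₂ hx.2
      exact ⟨b ∩ c, G.basis.inter_mem hb hc, ⟨hxb, hxc⟩, inter_subset_inter hbW hcW⟩
    | sUnion 𝓦 _ ih =>
      obtain ⟨W, hW, hxW⟩ := hx
      obtain ⟨b, hb, hxb, hbW⟩ := ih W hW hxW
      exact ⟨b, hb, hxb, hbW.trans (subset_sUnion_of_mem hW)⟩

/-! ### Regular vertices and continuation coverings -/

/-- Near a regular vertex every vertex is the range of an edge, since the compact set of edges
with range near that vertex has a closed image. -/
theorem exists_isContinuationCovering [T2Space E₀] [T2Space E₁] {v : E₀}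
    (hv : v ∈ G.regularVertices) :
    ∃ (A : Set E₀) (𝓑 : Set (Set E₁)), v ∈ A ∧ G.IsContinuationCovering A 𝓑 := by
  obtain ⟨⟨V, hV, hVc⟩, hvs⟩ := hv
  let A : Set E₀ := interior V ∩ (closure G.sources)ᶜ
  have hA : IsOpen A := isOpen_interior.inter isClosed_closure.isOpen_compl
  have hAV : A ⊆ V := inter_subset_left.trans interior_subset
  have hAr : A ⊆ range G.r := by
    intro w hw
    have hcl : w ∈ closure (range G.r) := by
      by_contra h
      exact hw.2 (subset_closure h)
    have h1 : w ∈ closure (A ∩ range G.r) := hA.inter_closure ⟨hw, hcl⟩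
    have h2 : A ∩ range G.r ⊆ G.r '' (G.r ⁻¹' V) := by
      rintro _ ⟨he, e, rfl⟩
      exact ⟨e, hAV he, rfl⟩
    obtain ⟨e, -, he⟩ :=
      closure_minimal h2 (hVc.image G.continuous_r).isClosed h1
    exact ⟨e, he⟩
  choose N hN hNe using isLocalHomeomorph_iff_isOpenEmbedding_restrict.1 G.isLocalHomeomorph_d
  obtain ⟨t, -, ht⟩ := hVc.elim_nhds_subcover (fun e => interior (N e))
    fun e _ => interior_mem_nhds.2 (hN e)
  refine ⟨A, (fun e => interior (N e) ∩ G.r ⁻¹' A) '' t, ⟨mem_interior_iff_mem_nhds.2 hV, hvs⟩,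
    hA, hAr, t.finite_toSet.image _, ?_, ?_⟩
  · rintro _ ⟨e, -, rfl⟩
    refine ⟨isOpen_interior.inter (hA.preimage G.continuous_r), ?_, ?_⟩
    · refine hVc.of_isClosed_subset isClosed_closure (closure_minimal ?_ hVc.isClosed)
      exact inter_subset_right.trans (preimage_mono hAV)
    · exact (hNe e).isEmbedding.comp
        (IsEmbedding.inclusion (inter_subset_left.trans interior_subset))
  · rw [sUnion_image, ← iUnion₂_inter, eq_comm, inter_eq_right]
    exact (preimage_mono hAV).trans ht

theorem mem_regularVertices_iff [T2Space E₀] [T2Space E₁] [LocallyCompactSpace E₀] {v : E₀} :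
    v ∈ G.regularVertices ↔
      ∃ (A : Set E₀) (𝓑 : Set (Set E₁)), v ∈ A ∧ G.IsContinuationCovering A 𝓑 := by
  refine ⟨exists_isContinuationCovering, ?_⟩
  rintro ⟨A, 𝓑, hvA, hA, hAr, hfin, hB, hU⟩
  refine ⟨?_, fun hv => ?_⟩
  · obtain ⟨V, hV, hvV, hVA⟩ := exists_compact_subset hA hvA
    refine ⟨V, mem_interior_iff_mem_nhds.1 hvV, ?_⟩
    refine (hfin.isCompact_biUnion fun B hB' => (hB B hB').2.1).of_isClosed_subset
      (hV.isClosed.preimage G.continuous_r) ?_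
    refine (preimage_mono hVA).trans (hU.subset.trans ?_)
    rw [sUnion_eq_biUnion]
    exact iUnion₂_mono fun B _ => subset_closure
  · obtain ⟨w, hwA, hws⟩ := mem_closure_iff.1 hv A hA hvA
    exact hws (subset_closure (hAr hwA))

/-! ### Paths respecting the coverings -/

/-- Every path respects the topological coverings. -/
theorem exists_mem_of_isTopologicalFamily {a : Set G.PathSpace} {S : Set (Set G.PathSpace)}
    (hS : IsTopologicalFamily a S) {x : G.PathSpace} (hx : x ∈ a) : ∃ s ∈ S, x ∈ s := by
  obtain ⟨n, U, K, 𝓤, -, -, rfl, -, rfl, rfl⟩ := hS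
  obtain ⟨ν, ⟨U', hU', hνU'⟩, hxν⟩ := mem_cyl_iff_exists.1 hx.1
  exact ⟨_, Or.inr ⟨U', hU', rfl⟩, mem_cyl_iff_exists.2 ⟨ν, hνU', hxν⟩, hx.2⟩

theorem extend_subset_of_dom {n : ℕ} {U : Set (G.FinPath n)} {𝓑 : Set (Set E₁)}
    (h𝓑 : G.r ⁻¹' (FinPath.dom '' U) = ⋃₀ 𝓑) {ν : G.FinPath (n + 1)}
    (hν : ν.take n n.le_succ ∈ U) : ∃ B ∈ 𝓑, ν ∈ extend U B := by
  have h : ν.1.2 (Fin.last n) ∈ ⋃₀ 𝓑 := h𝓑 ▸ ⟨_, hν, ν.dom_take⟩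
  obtain ⟨B, hB, hνB⟩ := h
  exact ⟨B, hB, hν, hνB⟩

/-- A boundary path respects the continuation coverings: it is not too short to be continued,
as its domain would then be a regular vertex. -/
theorem exists_mem_of_isContinuationFamily [T2Space E₀] [T2Space E₁] [LocallyCompactSpace E₀]
    {a : Set G.PathSpace} {S : Set (Set G.PathSpace)} (hS : IsContinuationFamily a S)
    {x : G.PathSpace} (hxb : x ∈ G.boundaryPathSpace) (hx : x ∈ a) : ∃ s ∈ S, x ∈ s := by
  obtain ⟨n, U, K, 𝓑, -, -, rfl, h𝓑, rfl⟩ := hS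
  obtain ⟨hxU, hxK⟩ := hx
  suffices h : ∃ B ∈ 𝓑, x ∈ cyl (extend U B) by
    obtain ⟨B, hB, hxB⟩ := h
    exact ⟨_, Or.inr ⟨B, hB, rfl⟩, hxB, hxK⟩
  rcases hxb with ⟨m, μ, rfl, hμ⟩ | ⟨ξ, rfl⟩
  · obtain ⟨hnm, hμU⟩ := hxU
    rcases hnm.eq_or_lt with rfl | hlt
    · exact absurd (mem_regularVertices_iff.2 ⟨FinPath.dom '' U, 𝓑, ⟨μ, hμU, rfl⟩, h𝓑⟩) hμ
    · obtain ⟨B, hB, h⟩ := extend_subset_of_dom (ν := μ.take (n + 1) hlt) h𝓑.2.2.2.2 hμU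
      exact ⟨B, hB, hlt, h⟩
  · obtain ⟨B, hB, h⟩ := extend_subset_of_dom (ν := ξ.take (n + 1)) h𝓑.2.2.2.2 hxU
    exact ⟨B, hB, h⟩

/-- A finite path that ends at a regular vertex violates a continuation covering. -/
theorem exists_isContinuationFamily_of_dom_mem_regularVertices [T2Space E₀] [T2Space E₁] {n : ℕ}
    {μ : G.FinPath n} (hμ : μ.dom ∈ G.regularVertices) :
    ∃ a ∈ G.basis.sets, ∃ S ⊆ G.basis.sets, IsContinuationFamily a S ∧
      PathSpace.fin n μ ∈ a ∧ ∀ s ∈ S, PathSpace.fin n μ ∉ s := by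
  obtain ⟨A, 𝓑, hμA, h𝓑⟩ := exists_isContinuationCovering hμ
  let U : Set (G.FinPath n) := FinPath.dom ⁻¹' A
  have hU : IsOpen U := h𝓑.1.preimage (continuous_dom n)
  have h𝓑' := h𝓑.mono (isOpenMap_dom n U hU) (image_preimage_subset _ A)
  refine ⟨_, ⟨n, U, ∅, hU, isCompact_empty, rfl⟩, _, ?_,
    ⟨n, U, ∅, _, hU, isCompact_empty, rfl, h𝓑', rfl⟩, ⟨fin_mem_cyl.2 hμA, ?_⟩, ?_⟩
  · rintro _ (rfl | ⟨B, hB, rfl⟩)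
    · refine ⟨n, ∅, ∅, isOpen_empty, isCompact_empty, (eq_empty_of_forall_notMem ?_).symm⟩
      rintro x ⟨hx, -⟩
      obtain ⟨ν, hν, -⟩ := mem_cyl_iff_exists.1 hx
      exact hν
    · exact ⟨n + 1, _, ∅, isOpen_extend hU (h𝓑'.2.2.2.1 B hB).1, isCompact_empty, rfl⟩
  · rw [cylStar_empty]
    exact id
  · rintro _ (rfl | ⟨B, -, rfl⟩) hμs
    · exact hμs
    · exact absurd hμs.1.1 (Nat.not_succ_le_self n)

end TopologicalGraph

theorem mainTheorem1 {E₀ E₁ : Type*} [TopologicalSpace E₀] [TopologicalSpace E₁]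
    [T2Space E₀] [T2Space E₁] [LocallyCompactSpace E₀] [LocallyCompactSpace E₁]
    (G : TopologicalGraph E₀ E₁) :
    G.basis.relationSubspace G.relations = G.boundaryPathSpace := by
  ext x
  rw [SetSemilattice.mem_relationSubspace_iff G.isTopologicalBasis_basis]
  constructor
  · intro h
    cases x with
    | inf ξ => exact Or.inr ⟨ξ, rfl⟩
    | fin n μ =>
      refine Or.inl ⟨n, μ, rfl, fun hμ => ?_⟩
      obtain ⟨a, ha, S, hSB, hS, hμa, hμS⟩ :=
        TopologicalGraph.exists_isContinuationFamily_of_dom_mem_regularVertices hμ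
      have hval : Subtype.val '' (Subtype.val ⁻¹' S : Set G.basis.Elem) = S := by
        rw [Subtype.image_preimage_coe]
        exact inter_eq_right.2 hSB
      obtain ⟨s, hs, hμs⟩ := h ⟨a, ha⟩ (Subtype.val ⁻¹' S) (Or.inl (by rwa [hval])) hμa
      exact hμS _ hs hμs
  · intro hx a S hS hxa
    have h : ∃ s ∈ Subtype.val '' S, x ∈ s := hS.elim
      (fun hS => TopologicalGraph.exists_mem_of_isContinuationFamily hS hx hxa)
      (fun hS => TopologicalGraph.exists_mem_of_isTopologicalFamily hS hxa)
    obtain ⟨_, ⟨s, hs, rfl⟩, hxs⟩ := h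
    exact ⟨s, hs, hxs⟩
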